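/- **Coarsely convex spaces.** Let $\lambda\ge 1$, $k\ge 0$, $E\ge 1$, $C\ge 0$, let $\theta:\mathbb R_{\ge0}\to\mathbb R_{\ge0}$ be non-decreasing. A metric space $X$ is *coarsely convex* with respect to $(\lambda,k,E,C,\theta)$ and a family $\mathcal L$ of $(\lambda,k)$-quasi-geodesic segments $\gamma:[0,a_\gamma]\to X$ (i.e. $\lambda^{-1}|t-s|-k\le d(\gamma(t),\gamma(s))\le\lambda|t-s|+k$) if any $v,w\in X$ are the initial and the terminal point of some $\gamma\in\mathcal L$, and for all $\gamma,\eta\in\mathcal L$, $t\in[0,a_\gamma]$, $s\in[0,a_\eta]$, $c\in[0,1]$, $$d(\gamma(ct),\eta(cs))\le cE\,d(\gamma(t),\eta(s))+(1-c)E\,d(\gamma(0),\eta(0))+C,\qquad |t-s|\le\theta\big(d(\gamma(0),\eta(0))+d(\gamma(t),\eta(s))\big).$$ Put $k_1=\lambda+k$ and $D=2(1+E)k_1+C$, and fix a base point $O\in X$. **Boundary and product.** Let $\mathcal L_O^\infty$ be the set of all $\gamma:\mathbb R_{\ge0}\to X$ with $\gamma(0)=O$ and $\gamma(t)=\gamma(\lfloor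 t\rfloor)$ for all $t$ for which there are $\gamma_n\in\mathcal L$ with $\gamma_n(0)=O$, $a_{\gamma_n}\to\infty$ and $\gamma_n(m)\to\gamma(m)$ for every $m\in\mathbb N$. The ideal boundary $\partial X$ is $\mathcal L_O^\infty$ modulo $\gamma\sim\eta\iff\sup_t d(\gamma(t),\eta(t))<\infty$. For $x\in X$ let $\bar{\mathcal L}_O(x)$ be the set of all $\gamma\in\mathcal L$ with $a_\gamma\ge2\theta(0)$, $\gamma(0)=O$, $\gamma(a_\gamma)=x$; for $\xi\in\partial X$ let $\bar{\mathcal L}_O(\xi)$ be the set of all $\gamma\in\mathcal L_O^\infty$ representing $\xi$. Put $$(\gamma\mid\eta)_O=\sup\{t\in\operatorname{Dom}\gamma\cap\operatorname{Dom}\eta: d(\gamma(t),\eta(t))\le2D+2\}.$$ For $p,q\in X\cup\partial X$, the product $(p\mid q)_O\in[0,\infty]$ is $0$ if $p$ or $q$ lies in the closed ball of radius $2\lambda\theta(0)+k$ around $O$, and otherwise it is the supremum of $(\gamma\mid\eta)_O$ over $\gamma\in\bar{\mathcal L}_O(p)$, $\eta\in\bar{\mathcal L}_O(q)$. The space $X\cup\partial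 X$ carries the topology in which the sets $V_n(p)=\{q:(p,q)\in V_n\}$, $n\ge1$, form a neighbourhood basis of $p$, where $V_n=\{(p,q):(p\mid q)_O>n\}\cup\{(x,y)\in X^2:d(x,y)<1/n\}$. **Maps.** Let $X$ and $Y$ be proper coarsely convex spaces (each with fixed constants and family as above) with base points $a\in X$ and $b\in Y$. A map $f:X\to Y$ is *visual* if there are $A\ge1$, $B\ge0$ with $d(f(x),f(x'))\le A\,d(x,x')+B$ for all $x,x'\in X$, and $(f(x_n)\mid f(y_n))_b\to\infty$ for all sequences $(x_n),(y_n)$ in $X$ with $(x_n\mid y_n)_a\to\infty$. **Proposition.** Let $f:X\to Y$ be a visual map and let $n\ge1$ be an integer. There is exactly one map $\partial f:\partial X\to\partial Y$ such that $\partial f([\gamma])=\lim_{m\to\infty}f(\gamma(m))$ in $Y\cup\partial Y$ for every $\gamma\in\mathcal L_a^\infty$ (the map induced by $f$), and the following are equivalent. (A) $\partial f$ is $n$-to-one, that is, every $z\in\partial Y$ has at most $n$ preimages under $\partial f$. (B) For every real $R>0$ there is a real $S>0$ such that for all $x_1,\dots,x_{n+1}\in X$ with $(x_i\mid x_j)_a<R$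 for all $i\ne j$ there are $1\le k<m\le n+1$ with $(f(x_k)\mid f(x_m))_b<S$. -/

import Mathlib

open Filter Topology
open scoped NNReal ENNReal

namespace CoarseConvex

universe u v

/-- A map `[0, len] → X`. It is stored as a map on `ℝ≥0`; its values outside `[0, len]` are never
used. -/
structure Segment (X : Type u) where
  len : ℝ≥0
  toFun : ℝ≥0 → X

/-- `γ : [0, len] → X` is a `(lam, k)`-quasi-geodesic segment. -/
def Segment.IsQuasiGeodesic {X : Type u} [MetricSpace X] (lam k : ℝ) (γ : Segment X) : Prop :=
  ∀ t s : ℝ≥0, t ≤ γ.len → s ≤ γ.len →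
    lam⁻¹ * |(t : ℝ) - s| - k ≤ dist (γ.toFun t) (γ.toFun s) ∧
      dist (γ.toFun t) (γ.toFun s) ≤ lam * |(t : ℝ) - s| + k

/-- The metric space `X` is `(lam, k, E, C, θ, L)`-coarsely convex, that is, `L` is a system of
good quasi-geodesic segments with these constants. -/
structure IsCoarselyConvex (X : Type u) [MetricSpace X] (lam k E C : ℝ) (θ : ℝ≥0 → ℝ≥0)
    (L : Set (Segment X)) : Prop where
  one_le_lam : 1 ≤ lam
  k_nonneg : 0 ≤ k
  one_le_E : 1 ≤ E
  C_nonneg : 0 ≤ C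
  θ_mono : Monotone θ
  quasiGeodesic : ∀ γ ∈ L, γ.IsQuasiGeodesic lam k
  connecting : ∀ v w : X, ∃ γ ∈ L, γ.toFun 0 = v ∧ γ.toFun γ.len = w
  convex : ∀ γ ∈ L, ∀ η ∈ L, ∀ t s c : ℝ≥0, t ≤ γ.len → s ≤ η.len → c ≤ 1 →
    dist (γ.toFun (c * t)) (η.toFun (c * s)) ≤
      c * E * dist (γ.toFun t) (η.toFun s)
        + (1 - (c : ℝ)) * E * dist (γ.toFun 0) (η.toFun 0) + C
  param : ∀ γ ∈ L, ∀ η ∈ L, ∀ t s : ℝ≥0, t ≤ γ.len → s ≤ η.len →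
    |(t : ℝ) - s| ≤
      θ (nndist (γ.toFun 0) (η.toFun 0) + nndist (γ.toFun t) (η.toFun s))

/-- A choice of constants and of a system of good quasi-geodesic segments that makes `X` a
coarsely convex space. -/
structure GoodSystem (X : Type u) [MetricSpace X] where
  lam : ℝ
  k : ℝ
  E : ℝ
  C : ℝ
  θ : ℝ≥0 → ℝ≥0
  L : Set (Segment X)
  isCoarselyConvex : IsCoarselyConvex X lam k E C θ L

namespace GoodSystem

variable {X : Type u} [MetricSpace X]

/-- The constant `k₁ = λ + k`. -/
def k₁ (S : GoodSystem X) : ℝ := S.lam + S.k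

/-- The constant `D = 2 (1 + E) k₁ + C`. -/
def D (S : GoodSystem X) : ℝ := 2 * (1 + S.E) * S.k₁ + S.C

/-- `γ : ℝ≥0 → X` is `L`-approximatable: there are `γₙ : [0, aₙ] → X` in `L` with `aₙ → ∞`,
`γₙ(0) = γ(0)`, converging to `γ` pointwise on `ℕ`. (For fixed `m`, the point `m` lies in the
domain of `γₙ` for all large `n`.) -/
def IsApproximatable (S : GoodSystem X) (γ : ℝ≥0 → X) : Prop :=
  ∃ σ : ℕ → Segment X, (∀ n, σ n ∈ S.L) ∧ Tendsto (fun n => (σ n).len) atTop atTop ∧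
    (∀ n, (σ n).toFun 0 = γ 0) ∧
    ∀ m : ℕ, Tendsto (fun n => (σ n).toFun m) atTop (𝓝 (γ m))

/-- The family `L^∞` of quasi-geodesic rays. -/
def Linf (S : GoodSystem X) : Set (ℝ≥0 → X) :=
  {γ | S.IsApproximatable γ ∧ ∀ t : ℝ≥0, γ t = γ (⌊t⌋₊ : ℝ≥0)}

/-- The subfamily `L_O^∞` of the rays starting at `O`. -/
def LinfAt (S : GoodSystem X) (O : X) : Set (ℝ≥0 → X) :=
  {γ | γ ∈ S.Linf ∧ γ 0 = O}

/-- Two rays are equivalent if `sup_t d(γ(t), η(t)) < ∞`. -/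
def raySetoid (S : GoodSystem X) (O : X) : Setoid (S.LinfAt O) where
  r γ η := BddAbove (Set.range fun t : ℝ≥0 => dist (γ.1 t) (η.1 t))
  iseqv :=
    { refl := fun γ => ⟨0, by rintro _ ⟨t, rfl⟩; simp⟩
      symm := by
        rintro γ η ⟨M, hM⟩
        refine ⟨M, ?_⟩
        rintro _ ⟨t, rfl⟩
        have := hM ⟨t, rfl⟩
        simpa [dist_comm] using this
      trans := by
        rintro γ η ξ ⟨M, hM⟩ ⟨N, hN⟩
        refine ⟨M + N, ?_⟩
        rintro _ ⟨t, rfl⟩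
        exact (dist_triangle _ (η.1 t) _).trans (add_le_add (hM ⟨t, rfl⟩) (hN ⟨t, rfl⟩)) }

/-- The ideal boundary of `X` with respect to the base point `O`. -/
def Boundary (S : GoodSystem X) (O : X) : Type u := Quotient (S.raySetoid O)

/-- The class `[γ]` of a ray. -/
def Boundary.mk (S : GoodSystem X) {O : X} (γ : S.LinfAt O) : S.Boundary O :=
  Quotient.mk (S.raySetoid O) γ

/-- `X ∪ ∂X`, a disjoint union. -/
abbrev Completion (S : GoodSystem X) (O : X) : Type u := X ⊕ S.Boundary O

end GoodSystem

/-- A segment or a ray: a map on a subset `dom` of `ℝ≥0` (values outside `dom` are never used). -/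
structure Curve (X : Type u) where
  dom : Set ℝ≥0
  toFun : ℝ≥0 → X

namespace GoodSystem

variable {X : Type u} [MetricSpace X]

/-- For `x ∈ X`: the segments `γ ∈ L` with `Dom γ = [0, a]`, `a ≥ 2 θ(0)`, `γ(0) = O`, `γ(a) = x`.
For `ξ ∈ ∂X`: the rays in `L_O^∞` that represent `ξ`. -/
def LbarAt (S : GoodSystem X) (O : X) : S.Completion O → Set (Curve X)
  | Sum.inl x => {c | ∃ γ ∈ S.L, 2 * S.θ 0 ≤ γ.len ∧ γ.toFun 0 = O ∧ γ.toFun γ.len = x ∧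
      c = ⟨Set.Iic γ.len, γ.toFun⟩}
  | Sum.inr ξ => {c | ∃ γ : S.LinfAt O, Boundary.mk S γ = ξ ∧ c = ⟨Set.univ, γ.1⟩}

/-- `(γ | η) = sup {t ∈ Dom γ ∩ Dom η : d(γ(t), η(t)) ≤ 2 D + 2}`, in `[0, ∞]`. -/
noncomputable def curveProd (S : GoodSystem X) (γ η : Curve X) : ℝ≥0∞ :=
  sSup ((fun t : ℝ≥0 => (t : ℝ≥0∞)) ''
    {t | t ∈ γ.dom ∩ η.dom ∧ dist (γ.toFun t) (η.toFun t) ≤ 2 * S.D + 2})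

/-- The closed ball of radius `2 λ θ(0) + k` around `O`, as a subset of `X ∪ ∂X`. -/
def nearBall (S : GoodSystem X) (O : X) : Set (S.Completion O) :=
  Sum.inl '' Metric.closedBall O (2 * S.lam * S.θ 0 + S.k)

open Classical in
/-- The product `(p | q)_O` on `X ∪ ∂X`, with values in `[0, ∞]`. -/
noncomputable def gprod (S : GoodSystem X) (O : X) (p q : S.Completion O) : ℝ≥0∞ :=
  if p ∈ S.nearBall O ∨ q ∈ S.nearBall O then 0
  else ⨆ γ ∈ S.LbarAt O p, ⨆ η ∈ S.LbarAt O q, S.curveProd γ η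

/-- The basic entourage `V_n` (`n ≥ 1`) of the uniform structure of `X ∪ ∂X`. -/
def entourage (S : GoodSystem X) (O : X) (n : ℕ) : Set (S.Completion O × S.Completion O) :=
  {pq | (n : ℝ≥0∞) < S.gprod O pq.1 pq.2} ∪
    {pq | ∃ x y : X, pq = (Sum.inl x, Sum.inl y) ∧ dist x y < (n : ℝ)⁻¹}

/-- The filter with basis `V_n(p) = {q : (p, q) ∈ V_n}`, `n ≥ 1`: the neighbourhood filter of `p`
in the topology of `X ∪ ∂X`. -/
def nhdsAt (S : GoodSystem X) (O : X) (p : S.Completion O) : Filter (S.Completion O) :=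
  ⨅ n : ℕ, ⨅ _ : 1 ≤ n, 𝓟 {q | (p, q) ∈ S.entourage O n}

end GoodSystem

section Maps

variable {X : Type u} {Y : Type v} [MetricSpace X] [MetricSpace Y]

/-- Large scale Lipschitz maps. -/
def IsLargeScaleLipschitz (f : X → Y) : Prop :=
  ∃ A B : ℝ, 1 ≤ A ∧ 0 ≤ B ∧ ∀ x x' : X, dist (f x) (f x') ≤ A * dist x x' + B

/-- Visual maps. -/
def IsVisual (S : GoodSystem X) (T : GoodSystem Y) (a : X) (b : Y) (f : X → Y) : Prop :=
  IsLargeScaleLipschitz f ∧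
    ∀ x y : ℕ → X,
      Tendsto (fun n => S.gprod a (Sum.inl (x n)) (Sum.inl (y n))) atTop (𝓝 ∞) →
      Tendsto (fun n => T.gprod b (Sum.inl (f (x n))) (Sum.inl (f (y n)))) atTop (𝓝 ∞)

/-- `g : ∂X → ∂Y` is induced by `f`: for every ray `γ ∈ L_a^∞`, the points `f(γ(n))` converge to
`g([γ])` in `Y ∪ ∂Y`. -/
def IsInducedBy (S : GoodSystem X) (T : GoodSystem Y) (a : X) (b : Y) (f : X → Y)
    (g : S.Boundary a → T.Boundary b) : Prop :=
  ∀ γ : S.LinfAt a,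
    Tendsto (fun n : ℕ => (Sum.inl (f (γ.1 n)) : T.Completion b)) atTop
      (T.nhdsAt b (Sum.inr (g (GoodSystem.Boundary.mk S γ))))

/-- Visually `n`-to-one maps. -/
def IsVisuallyNToOne (S : GoodSystem X) (T : GoodSystem Y) (a : X) (b : Y) (n : ℕ)
    (f : X → Y) : Prop :=
  ∀ R : ℝ, 0 < R → ∃ r : ℝ, 0 < r ∧ ∀ x : Fin (n + 1) → X,
    (∀ i j, i ≠ j → S.gprod a (Sum.inl (x i)) (Sum.inl (x j)) < ENNReal.ofReal R) →
    ∃ k m, k < m ∧ T.gprod b (Sum.inl (f (x k))) (Sum.inl (f (x m))) < ENNReal.ofReal r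

end Maps

/-- A map is `n`-to-one if its point-inverses contain at most `n` points. -/
def IsNToOne {P : Type u} {Q : Type v} (n : ℕ) (g : P → Q) : Prop :=
  ∀ q : Q, (g ⁻¹' {q}).encard ≤ n

end CoarseConvex

/-! By coarse convexity, curves issuing from `O` that are within any fixed distance `K` at a
sufficiently late time are `2 D + 2`-close up to any prescribed earlier time
(`exists_near_of_dist_le`). So a large product amounts to long fellow-travelling, whichever
representatives are used (`exists_near_of_lt_gprod`, `exists_lt_gprod_of_near`), and "the product
tends to `∞`" is a symmetric and transitive relation between families of points
(`tendsto_gprod_trans`).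

Three further facts suffice: rays converge to their classes, boundary limits are unique, and in a
proper space points going to infinity subconverge to the boundary. A visual map then induces a
boundary map. If (B) fails, `n + 1` sequences with bounded mutual products have images with
diverging products; their sublimits are distinct boundary points with the same image. Conversely,
points running along rays to `n + 1` distinct preimages of one point violate (B). -/

namespace CoarseConvex

universe u v

namespace GoodSystem

/-! ### Fellow-travelling of curves and its equivalence with large products -/

section Curves

variable {X : Type u} [MetricSpace X] (S : GoodSystem X) {O : X}

lemma one_le_k₁ : 1 ≤ S.k₁ := by
  have h1 := S.isCoarselyConvex.one_le_lam
  have h2 := S.isCoarselyConvex.k_nonneg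
  unfold k₁; linarith

lemma four_mul_k₁_add_C_le_D : 4 * S.k₁ + S.C ≤ S.D := by
  have h1 := S.isCoarselyConvex.one_le_E
  have h2 := S.one_le_k₁
  unfold D; nlinarith

lemma lam_pos : 0 < S.lam := lt_of_lt_of_le one_pos S.isCoarselyConvex.one_le_lam

/-- The curves that are segments in `L` or rays in `L^∞`, starting at `O`. -/
def IsGoodCurve (O : X) (c : Curve X) : Prop :=
  (∃ γ ∈ S.L, γ.toFun 0 = O ∧ c = ⟨Set.Iic γ.len, γ.toFun⟩) ∨
    ∃ γ : S.LinfAt O, c = ⟨Set.univ, γ.1⟩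

variable {S}

lemma isGoodCurve_of_mem_LbarAt {p : S.Completion O} {c : Curve X} (hc : c ∈ S.LbarAt O p) :
    S.IsGoodCurve O c := by
  rcases p with x | ξ
  · obtain ⟨γ, hγ, -, h0, -, rfl⟩ := hc
    exact Or.inl ⟨γ, hγ, h0, rfl⟩
  · obtain ⟨γ, -, rfl⟩ := hc
    exact Or.inr ⟨γ, rfl⟩

lemma IsGoodCurve.mem_dom_of_le {c : Curve X} (hc : S.IsGoodCurve O c) {s t : ℝ≥0}
    (hst : s ≤ t) (ht : t ∈ c.dom) : s ∈ c.dom := by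
  rcases hc with ⟨γ, -, -, rfl⟩ | ⟨γ, rfl⟩
  · exact hst.trans ht
  · trivial

lemma dist_floor_le {γ : Segment X} (hγ : γ ∈ S.L) {t : ℝ≥0} (ht : t ≤ γ.len) :
    dist (γ.toFun (⌊t⌋₊ : ℝ≥0)) (γ.toFun t) ≤ S.k₁ := by
  have hfl : ((⌊t⌋₊ : ℝ≥0)) ≤ t := Nat.floor_le zero_le
  have h := (S.isCoarselyConvex.quasiGeodesic γ hγ _ _ (hfl.trans ht) ht).2
  have h1 : t < (⌊t⌋₊ : ℝ≥0) + 1 := Nat.lt_floor_add_one t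
  have h1' : (t : ℝ) < ((⌊t⌋₊ : ℝ≥0) : ℝ) + 1 := by exact_mod_cast h1
  have h2' : ((⌊t⌋₊ : ℝ≥0) : ℝ) ≤ t := by exact_mod_cast hfl
  have h3 : |((⌊t⌋₊ : ℝ≥0) : ℝ) - t| ≤ 1 := by rw [abs_le]; constructor <;> linarith
  have := S.lam_pos
  unfold k₁
  nlinarith

/-- Lets rays inherit the axioms for segments in `L`. Only finitely many integers are at most `N`,
so pointwise convergence gives error 1 on all of them; rounding the time down costs `k₁`. -/
lemma IsGoodCurve.exists_approx {c : Curve X} (hc : S.IsGoodCurve O c) (N : ℝ≥0) :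
    ∃ γ ∈ S.L, γ.toFun 0 = O ∧ ∀ t ∈ c.dom, t ≤ N →
      t ≤ γ.len ∧ dist (c.toFun t) (γ.toFun t) ≤ S.k₁ + 1 := by
  have hk := S.one_le_k₁
  rcases hc with ⟨γ, hγ, h0, rfl⟩ | ⟨⟨γ, ⟨⟨σ, hσL, hlen, hσ0, hlim⟩, hfloor⟩, h0⟩, rfl⟩
  · exact ⟨γ, hγ, h0, fun t ht _ => ⟨ht, by simp; linarith⟩⟩
  · have h1 : ∀ᶠ n in atTop, ∀ m ∈ Finset.range (⌊N⌋₊ + 1),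
        dist ((σ n).toFun m) (γ m) < 1 := by
      rw [Filter.eventually_all_finset]
      intro m _
      exact (Metric.tendsto_nhds.1 (hlim m)) 1 one_pos
    obtain ⟨n, hn1, hn2⟩ := (h1.and (hlen.eventually_ge_atTop N)).exists
    refine ⟨σ n, hσL n, (hσ0 n).trans h0, fun t _ ht => ⟨ht.trans hn2, ?_⟩⟩
    have h2 := hn1 ⌊t⌋₊ (Finset.mem_range.2 (Nat.lt_succ_of_le (Nat.floor_le_floor ht)))
    have h3 := dist_floor_le (hσL n) (ht.trans hn2)
    change dist (γ t) _ ≤ _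
    rw [hfloor t]
    have h4 := dist_triangle_left (γ (⌊t⌋₊ : ℝ≥0)) ((σ n).toFun t) ((σ n).toFun (⌊t⌋₊ : ℝ≥0))
    linarith

/-- Two curves stay `2 D + 2`-close up to time `R`. -/
def Near (S : GoodSystem X) (c c' : Curve X) (R : ℝ≥0) : Prop :=
  ∀ t ≤ R, t ∈ c.dom ∧ t ∈ c'.dom ∧ dist (c.toFun t) (c'.toFun t) ≤ 2 * S.D + 2

lemma Near.symm {c c' : Curve X} {R : ℝ≥0} (h : S.Near c c' R) : S.Near c' c R :=
  fun t ht => ⟨(h t ht).2.1, (h t ht).1, dist_comm (c.toFun t) _ ▸ (h t ht).2.2⟩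

variable (S O) in
-- Convexity with a common origin contracts the distance at time `t` by the factor `s / t`, up to
-- `E` and `C`. For `t ≥ R * M` what remains of it is at most 1, so the bound no longer depends on
-- `K`.
lemma exists_near_of_dist_le (K : ℝ) (R : ℝ≥0) : ∃ R' : ℝ≥0, ∀ c c' : Curve X,
    S.IsGoodCurve O c → S.IsGoodCurve O c' → ∀ t, R' ≤ t → t ∈ c.dom → t ∈ c'.dom →
      dist (c.toFun t) (c'.toFun t) ≤ K → S.Near c c' R := by
  have hk := S.one_le_k₁
  have hD := S.four_mul_k₁_add_C_le_D
  have hE := S.isCoarselyConvex.one_le_E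
  have hC := S.isCoarselyConvex.C_nonneg
  set M : ℝ := S.E * (|K| + 2 * (S.k₁ + 1)) with hM
  have hM1 : 1 ≤ M := by nlinarith [abs_nonneg K]
  refine ⟨R * M.toNNReal, fun c c' hc hc' t hRt ht ht' hd s hs => ?_⟩
  have hMc : (M.toNNReal : ℝ) = M := Real.coe_toNNReal _ (by linarith)
  have hRt' : (R : ℝ) * M ≤ t := by rw [← hMc]; exact_mod_cast hRt
  have hs' : (s : ℝ) ≤ R := by exact_mod_cast hs
  have hst' : (s : ℝ) * M ≤ t := by nlinarith
  have hst : s ≤ t := by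
    have : (s : ℝ) ≤ t := by nlinarith [s.coe_nonneg]
    exact_mod_cast this
  have hsc := hc.mem_dom_of_le hst ht
  have hsc' := hc'.mem_dom_of_le hst ht'
  refine ⟨hsc, hsc', ?_⟩
  obtain ⟨γ, hγ, h0, hγc⟩ := hc.exists_approx t
  obtain ⟨η, hη, h0', hηc⟩ := hc'.exists_approx t
  have hu : s / t * t = s := by
    rcases eq_or_ne t 0 with rfl | h
    · simpa using (le_antisymm hst zero_le).symm
    · exact div_mul_cancel₀ s h
  have hu1 : s / t ≤ 1 := div_le_one_of_le₀ hst zero_le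
  have hconv := S.isCoarselyConvex.convex γ hγ η hη t t (s / t) (hγc t ht le_rfl).1
    (hηc t ht' le_rfl).1 hu1
  rw [hu, h0, h0', dist_self, mul_zero, add_zero] at hconv
  have h1 := (hγc t ht le_rfl).2
  have h2 := (hηc t ht' le_rfl).2
  have h3 := (hγc s hsc hst).2
  have h4 := (hηc s hsc' hst).2
  have h5 : dist (γ.toFun t) (η.toFun t) ≤ |K| + 2 * (S.k₁ + 1) := by
    have e1 := dist_triangle4 (γ.toFun t) (c.toFun t) (c'.toFun t) (η.toFun t)
    rw [dist_comm (γ.toFun t) (c.toFun t)] at e1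
    have := le_abs_self K
    linarith
  have h6 : dist (c.toFun s) (c'.toFun s) ≤ dist (γ.toFun s) (η.toFun s) + 2 * (S.k₁ + 1) := by
    have e1 := dist_triangle4 (c.toFun s) (γ.toFun s) (η.toFun s) (c'.toFun s)
    rw [dist_comm (η.toFun s) (c'.toFun s)] at e1
    linarith
  have h7 : ((s / t : ℝ≥0) : ℝ) * S.E * dist (γ.toFun t) (η.toFun t) ≤ 1 := by
    have hnn : 0 ≤ ((s / t : ℝ≥0) : ℝ) := NNReal.coe_nonneg _
    calc ((s / t : ℝ≥0) : ℝ) * S.E * dist (γ.toFun t) (η.toFun t)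
        ≤ ((s / t : ℝ≥0) : ℝ) * S.E * (|K| + 2 * (S.k₁ + 1)) := by gcongr
      _ = s * M / t := by rw [hM]; push_cast; ring
      _ ≤ 1 := div_le_one_of_le₀ hst' t.coe_nonneg
  linarith

variable (S O) in
lemma exists_near_trans (R : ℝ≥0) : ∃ R' : ℝ≥0, ∀ c c' c'' : Curve X,
    S.IsGoodCurve O c → S.IsGoodCurve O c'' → S.Near c c' R' → S.Near c' c'' R' →
      S.Near c c'' R := by
  obtain ⟨R', h⟩ := exists_near_of_dist_le S O (2 * (2 * S.D + 2)) R
  refine ⟨R', fun c c' c'' hc hc'' h1 h2 => h c c'' hc hc'' R' le_rfl (h1 R' le_rfl).1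
    (h2 R' le_rfl).2.1 ?_⟩
  have := dist_triangle (c.toFun R') (c'.toFun R') (c''.toFun R')
  linarith [(h1 R' le_rfl).2.2, (h2 R' le_rfl).2.2]

/-- Turns closeness at different times into closeness at a common time: `θ` bounds the time
difference, and the longer segment moves little in between. -/
lemma dist_min_le {γ η : Segment X} (hγ : γ ∈ S.L) (hη : η ∈ S.L) (h0 : γ.toFun 0 = η.toFun 0)
    {t s K : ℝ≥0} (ht : t ≤ γ.len) (hs : s ≤ η.len) (hK : nndist (γ.toFun t) (η.toFun s) ≤ K) :
    |(t : ℝ) - s| ≤ S.θ K ∧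
      dist (γ.toFun (min t s)) (η.toFun (min t s)) ≤ S.lam * S.θ K + S.k + K := by
  have hθ : |(t : ℝ) - s| ≤ S.θ K := by
    refine (S.isCoarselyConvex.param γ hγ η hη t s ht hs).trans ?_
    rw [h0, nndist_self, zero_add]
    exact_mod_cast S.isCoarselyConvex.θ_mono hK
  have hK' : dist (γ.toFun t) (η.toFun s) ≤ K := by exact_mod_cast hK
  refine ⟨hθ, ?_⟩
  have hlam := S.lam_pos
  have hmul := mul_le_mul_of_nonneg_left hθ hlam.le
  rcases le_total t s with h | h
  · rw [min_eq_left h]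
    have h1 := (S.isCoarselyConvex.quasiGeodesic η hη s t hs (h.trans hs)).2
    rw [abs_sub_comm] at h1
    have := dist_triangle (γ.toFun t) (η.toFun s) (η.toFun t)
    linarith
  · rw [min_eq_right h]
    have h1 := (S.isCoarselyConvex.quasiGeodesic γ hγ s t (h.trans ht) ht).2
    rw [abs_sub_comm] at h1
    have := dist_triangle (γ.toFun s) (γ.toFun t) (η.toFun s)
    linarith

variable (S O) in
lemma exists_near_of_mem_LbarAt (R : ℝ≥0) : ∃ R' : ℝ≥0, ∀ (p : S.Completion O) (c c' : Curve X),
    c ∈ S.LbarAt O p → c' ∈ S.LbarAt O p → R' ∈ c.dom → S.Near c c' R := by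
  obtain ⟨R', h⟩ := exists_near_of_dist_le S O (S.lam * S.θ 0 + S.k + (0 : ℝ≥0)) R
  -- Two segments to the same point have lengths differing by at most `θ 0`; the margin keeps the
  -- shorter one at least `R'` long.
  refine ⟨R' + S.θ 0, fun p c c' hc hc' hR => ?_⟩
  have gc := isGoodCurve_of_mem_LbarAt hc
  have gc' := isGoodCurve_of_mem_LbarAt hc'
  rcases p with x | ξ
  · obtain ⟨γ, hγ, -, h0, h1, rfl⟩ := hc
    obtain ⟨η, hη, -, h0', h1', rfl⟩ := hc'
    obtain ⟨h2, h3⟩ := dist_min_le (K := 0) hγ hη (h0.trans h0'.symm) le_rfl le_rfl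
      (by rw [h1, h1', nndist_self])
    refine h _ _ gc gc' _ ?_ (min_le_left γ.len η.len) (min_le_right γ.len η.len) h3
    have hR' : R' + S.θ 0 ≤ γ.len := hR
    rw [← NNReal.coe_le_coe] at hR' ⊢
    push_cast at hR' ⊢
    have := (abs_le.1 h2).2
    have := (S.θ 0).coe_nonneg
    exact le_min (by linarith) (by linarith)
  · obtain ⟨γ, hγ, rfl⟩ := hc
    obtain ⟨η, hη, rfl⟩ := hc'
    obtain ⟨M, hM⟩ : BddAbove (Set.range fun t : ℝ≥0 => dist (γ.1 t) (η.1 t)) :=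
      Quotient.exact (hγ.trans hη.symm)
    -- `M` and `R₁` depend on the pair of rays, but rays are defined at all times, so the uniform
    -- threshold is not affected.
    obtain ⟨R₁, h₁⟩ := exists_near_of_dist_le S O M R
    exact h₁ _ _ gc gc' R₁ le_rfl trivial trivial (hM ⟨R₁, rfl⟩)

lemma gprod_comm (p q : S.Completion O) : S.gprod O p q = S.gprod O q p := by
  unfold gprod
  split_ifs
  · rfl
  · tauto
  · tauto
  · rw [iSup₂_comm]
    congr! 6 with η - γ -
    unfold curveProd
    simp only [dist_comm, Set.inter_comm]

lemma exists_of_lt_gprod {p q : S.Completion O} {R : ℝ≥0} (h : (R : ℝ≥0∞) < S.gprod O p q) :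
    ∃ c ∈ S.LbarAt O p, ∃ c' ∈ S.LbarAt O q, ∃ t, R ≤ t ∧ t ∈ c.dom ∧ t ∈ c'.dom ∧
      dist (c.toFun t) (c'.toFun t) ≤ 2 * S.D + 2 := by
  unfold gprod at h
  split_ifs at h
  · simp at h
  simp only [lt_iSup_iff, curveProd, lt_sSup_iff] at h
  obtain ⟨c, hc, c', hc', _, ⟨t, ⟨ht, hd⟩, rfl⟩, hRt⟩ := h
  exact ⟨c, hc, c', hc', t, ENNReal.coe_le_coe.1 hRt.le, ht.1, ht.2, hd⟩

variable (S O) in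
-- The supremum provides only one pair `c₀`, `c₀'`, close at a single late time. Arbitrary
-- representatives are compared along the chain `c`, `c₀`, `c₀'`, `c'`, with the constants chosen
-- backwards from `R`.
lemma exists_near_of_lt_gprod (R : ℝ≥0) : ∃ R' : ℝ≥0, ∀ p q : S.Completion O,
    R' < S.gprod O p q → (S.LbarAt O p).Nonempty ∧ (S.LbarAt O q).Nonempty ∧
      ∀ c ∈ S.LbarAt O p, ∀ c' ∈ S.LbarAt O q, S.Near c c' R := by
  obtain ⟨R₁, h₁⟩ := exists_near_trans S O R
  obtain ⟨R₂, h₂⟩ := exists_near_trans S O R₁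
  obtain ⟨R₃, h₃⟩ := exists_near_of_mem_LbarAt S O (max R₁ R₂)
  obtain ⟨R₄, h₄⟩ := exists_near_of_dist_le S O (2 * S.D + 2) R₂
  refine ⟨max R₃ R₄, fun p q hpq => ?_⟩
  obtain ⟨c₀, hc₀, c₀', hc₀', t, ht, htc, htc', hd⟩ := exists_of_lt_gprod hpq
  refine ⟨⟨c₀, hc₀⟩, ⟨c₀', hc₀'⟩, fun c hc c' hc' => ?_⟩
  have g₀ := isGoodCurve_of_mem_LbarAt hc₀
  have g₀' := isGoodCurve_of_mem_LbarAt hc₀'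
  have g := isGoodCurve_of_mem_LbarAt hc
  have g' := isGoodCurve_of_mem_LbarAt hc'
  have n₁ := h₃ p c₀ c hc₀ hc (g₀.mem_dom_of_le ((le_max_left _ _).trans ht) htc)
  have n₂ := h₃ q c₀' c' hc₀' hc' (g₀'.mem_dom_of_le ((le_max_left _ _).trans ht) htc')
  have n₃ := h₄ c₀ c₀' g₀ g₀' t ((le_max_right _ _).trans ht) htc htc' hd
  have n₄ := h₂ c c₀ c₀' g g₀' (fun s hs => n₁.symm s (hs.trans (le_max_right _ _))) n₃
  exact h₁ c c₀' c' g g' n₄ (fun s hs => n₂ s (hs.trans (le_max_left _ _)))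

variable (S O) in
lemma exists_lt_dist_of_le_len (R : ℝ) : ∃ R' : ℝ≥0, ∀ γ ∈ S.L, γ.toFun 0 = O →
    ∀ t ≤ γ.len, R' ≤ t → R < dist O (γ.toFun t) := by
  refine ⟨(S.lam * (R + S.k + 1)).toNNReal, fun γ hγ h0 t ht hR => ?_⟩
  have h1 := (S.isCoarselyConvex.quasiGeodesic γ hγ 0 t zero_le ht).1
  rw [h0] at h1
  have hlam := S.lam_pos
  have h2 : S.lam * (R + S.k + 1) ≤ t := Real.toNNReal_le_iff_le_coe.1 hR
  have h3 : R + S.k + 1 ≤ S.lam⁻¹ * t := by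
    rwa [le_inv_mul_iff₀ hlam]
  simp only [NNReal.coe_zero, zero_sub, abs_neg, NNReal.abs_eq] at h1
  linarith

variable (S O) in
lemma exists_notMem_nearBall (R : ℝ) : ∃ R' : ℝ≥0, ∀ (p : S.Completion O),
    ∀ c ∈ S.LbarAt O p, R' ∈ c.dom → p ∉ S.nearBall O ∧ ∀ x, p = Sum.inl x → R < dist O x := by
  obtain ⟨R', h⟩ := exists_lt_dist_of_le_len S O (max R (2 * S.lam * S.θ 0 + S.k))
  refine ⟨R', fun p c hc hR => ?_⟩
  rcases p with x | ξ
  · obtain ⟨γ, hγ, -, h0, h1, rfl⟩ := hc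
    have h2 := h γ hγ h0 γ.len le_rfl hR
    rw [h1, max_lt_iff] at h2
    refine ⟨?_, fun y hy => by obtain rfl := Sum.inl_injective hy; exact h2.1⟩
    rintro ⟨y, hy, hyx⟩
    obtain rfl := Sum.inl_injective hyx
    rw [Metric.mem_closedBall, dist_comm] at hy
    linarith [h2.2]
  · exact ⟨fun ⟨y, _, hy⟩ => Sum.inl_ne_inr hy, fun x hx => (Sum.inr_ne_inl hx).elim⟩

variable (S O) in
lemma exists_lt_gprod_of_near (R : ℝ≥0) : ∃ R' : ℝ≥0, ∀ (p q : S.Completion O),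
    ∀ c ∈ S.LbarAt O p, ∀ c' ∈ S.LbarAt O q, S.Near c c' R' → R < S.gprod O p q := by
  obtain ⟨R', h⟩ := exists_notMem_nearBall S O 0
  -- `R'` forces both points out of the ball where the product is set to 0; `R + 1` makes the
  -- inequality strict.
  refine ⟨max R' (R + 1), fun p q c hc c' hc' hn => ?_⟩
  have hp := (h p c hc (hn R' (le_max_left _ _)).1).1
  have hq := (h q c' hc' (hn R' (le_max_left _ _)).2.1).1
  unfold gprod
  rw [if_neg (by tauto)]
  simp only [lt_iSup_iff, curveProd, lt_sSup_iff]
  have h1 := hn (R + 1) (le_max_right _ _)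
  refine ⟨c, hc, c', hc', _, ⟨R + 1, ⟨⟨h1.1, h1.2.1⟩, h1.2.2⟩, rfl⟩, ?_⟩
  exact ENNReal.coe_lt_coe.2 (lt_add_one R)

variable (S O) in
lemma exists_mem_LbarAt_of_lt_dist (R : ℝ≥0) : ∃ R' : ℝ, ∀ x, R' < dist O x →
    ∃ γ ∈ S.L, γ.toFun 0 = O ∧ γ.toFun γ.len = x ∧ R ≤ γ.len ∧
      (⟨Set.Iic γ.len, γ.toFun⟩ : Curve X) ∈ S.LbarAt O (Sum.inl x) := by
  refine ⟨S.lam * max R (2 * S.θ 0) + S.k, fun x hx => ?_⟩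
  obtain ⟨γ, hγ, h0, h1⟩ := S.isCoarselyConvex.connecting O x
  have h2 := (S.isCoarselyConvex.quasiGeodesic γ hγ 0 γ.len zero_le le_rfl).2
  rw [h0, h1] at h2
  simp only [NNReal.coe_zero, zero_sub, abs_neg, NNReal.abs_eq] at h2
  have h3 : max R (2 * S.θ 0) ≤ γ.len := by
    rw [← NNReal.coe_le_coe]
    exact le_of_mul_le_mul_left (by linarith) S.lam_pos
  exact ⟨γ, hγ, h0, h1, (le_max_left _ _).trans h3,
    γ, hγ, (le_max_right _ _).trans h3, h0, h1, rfl⟩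

end Curves

/-! ### Divergence of the product, and convergence to boundary points -/

section Limits

variable {X : Type u} [MetricSpace X] {S : GoodSystem X} {O : X} {ι : Type*} {l : Filter ι}

lemma tendsto_gprod_iff {p q : ι → S.Completion O} :
    Tendsto (fun i => S.gprod O (p i) (q i)) l (𝓝 ∞) ↔
      ∀ R : ℝ≥0, ∀ᶠ i in l, R < S.gprod O (p i) (q i) :=
  ENNReal.tendsto_nhds_top_iff_nnreal

lemma tendsto_gprod_comm {p q : ι → S.Completion O} :
    Tendsto (fun i => S.gprod O (p i) (q i)) l (𝓝 ∞) ↔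
      Tendsto (fun i => S.gprod O (q i) (p i)) l (𝓝 ∞) := by
  simp only [gprod_comm]

lemma tendsto_gprod_trans {p q r : ι → S.Completion O}
    (h₁ : Tendsto (fun i => S.gprod O (p i) (q i)) l (𝓝 ∞))
    (h₂ : Tendsto (fun i => S.gprod O (q i) (r i)) l (𝓝 ∞)) :
    Tendsto (fun i => S.gprod O (p i) (r i)) l (𝓝 ∞) := by
  rw [tendsto_gprod_iff] at *
  intro R
  obtain ⟨R₁, k₁⟩ := exists_lt_gprod_of_near S O R
  obtain ⟨R₂, k₂⟩ := exists_near_trans S O R₁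
  obtain ⟨R₃, k₃⟩ := exists_near_of_lt_gprod S O R₂
  filter_upwards [h₁ R₃, h₂ R₃] with i e₁ e₂
  obtain ⟨⟨c, hc⟩, ⟨c', hc'⟩, n₁⟩ := k₃ _ _ e₁
  obtain ⟨-, ⟨c'', hc''⟩, n₂⟩ := k₃ _ _ e₂
  exact k₁ _ _ c hc c'' hc'' (k₂ c c' c'' (isGoodCurve_of_mem_LbarAt hc)
    (isGoodCurve_of_mem_LbarAt hc'') (n₁ c hc c' hc') (n₂ c' hc' c'' hc''))

lemma tendsto_dist_of_tendsto_gprod {x : ι → X} {q : ι → S.Completion O}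
    (h : Tendsto (fun i => S.gprod O (Sum.inl (x i)) (q i)) l (𝓝 ∞)) :
    Tendsto (fun i => dist O (x i)) l atTop := by
  rw [tendsto_gprod_iff] at h
  rw [tendsto_atTop]
  intro R
  obtain ⟨R₁, k₁⟩ := exists_notMem_nearBall S O R
  obtain ⟨R₂, k₂⟩ := exists_near_of_lt_gprod S O R₁
  filter_upwards [h R₂] with i hi
  obtain ⟨⟨c, hc⟩, ⟨c', hc'⟩, n⟩ := k₂ _ _ hi
  exact ((k₁ _ c hc (n c hc c' hc' R₁ le_rfl).1).2 _ rfl).le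

/-- The metric part of an entourage contains no pair with a boundary point, so only the product
matters here. -/
lemma tendsto_nhdsAt_inr_iff {q : ι → S.Completion O} {ξ : S.Boundary O} :
    Tendsto q l (S.nhdsAt O (Sum.inr ξ)) ↔
      Tendsto (fun i => S.gprod O (q i) (Sum.inr ξ)) l (𝓝 ∞) := by
  have key : ∀ (n : ℕ) (r : S.Completion O),
      (Sum.inr ξ, r) ∈ S.entourage O n ↔ (n : ℝ≥0∞) < S.gprod O (Sum.inr ξ) r := by
    intro n r
    simp [entourage]
  simp only [nhdsAt, tendsto_iInf, tendsto_principal, Set.mem_ofPred_eq, key]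
  rw [tendsto_gprod_comm, ENNReal.tendsto_nhds_top_iff_nat]
  refine ⟨fun h n => ?_, fun h n _ => h n⟩
  filter_upwards [h (n + 1) (Nat.le_add_left 1 n)] with i hi
  exact lt_of_le_of_lt (by exact_mod_cast Nat.le_succ n) hi

lemma eq_of_forall_lt_gprod {ξ ζ : S.Boundary O}
    (h : ∀ R : ℝ≥0, R < S.gprod O (Sum.inr ξ) (Sum.inr ζ)) : ξ = ζ := by
  induction ξ using Quotient.inductionOn with | _ γ
  induction ζ using Quotient.inductionOn with | _ η
  refine Quotient.sound ⟨2 * S.D + 2, ?_⟩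
  rintro _ ⟨t, rfl⟩
  obtain ⟨R, k⟩ := exists_near_of_lt_gprod S O t
  exact ((k _ _ (h R)).2.2 _ ⟨γ, rfl, rfl⟩ _ ⟨η, rfl, rfl⟩ t le_rfl).2.2

lemma eq_of_tendsto_gprod [l.NeBot] {q : ι → S.Completion O} {ξ ζ : S.Boundary O}
    (h₁ : Tendsto (fun i => S.gprod O (q i) (Sum.inr ξ)) l (𝓝 ∞))
    (h₂ : Tendsto (fun i => S.gprod O (q i) (Sum.inr ζ)) l (𝓝 ∞)) : ξ = ζ := by
  have h := tendsto_gprod_trans (tendsto_gprod_comm.1 h₁) h₂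
  rw [tendsto_gprod_iff] at h
  exact eq_of_forall_lt_gprod fun R => (h R).exists.choose_spec

/-- A segment `σ` to `γ(m)` is compared with a segment `η` approximating the ray. Its endpoint is
`K`-close to `η(m)`, so `dist_min_le` makes `σ` and `η`, hence `σ` and the ray, close at a late
common time. -/
lemma tendsto_gprod_ray (γ : S.LinfAt O) :
    Tendsto (fun m : ℕ => S.gprod O (Sum.inl (γ.1 m)) (Sum.inr (Boundary.mk S γ))) atTop
      (𝓝 ∞) := by
  rw [tendsto_gprod_iff]
  intro R
  have hk := S.one_le_k₁
  have g : S.IsGoodCurve O ⟨Set.univ, γ.1⟩ := Or.inr ⟨γ, rfl⟩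
  set K : ℝ≥0 := (S.k₁ + 1).toNNReal with hKdef
  have hK : (K : ℝ) = S.k₁ + 1 := Real.coe_toNNReal _ (by linarith)
  obtain ⟨R₁, k₁⟩ := exists_lt_gprod_of_near S O R
  obtain ⟨R₂, k₂⟩ := exists_near_of_dist_le S O (S.lam * S.θ K + S.k + K + (S.k₁ + 1)) R₁
  obtain ⟨R₃, k₃⟩ := exists_mem_LbarAt_of_lt_dist S O R₂
  obtain ⟨R₄, k₄⟩ := exists_lt_dist_of_le_len S O (R₃ + K)
  filter_upwards [eventually_ge_atTop ⌈max R₂ R₄⌉₊] with m hm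
  have hm' : max R₂ R₄ ≤ (m : ℝ≥0) := Nat.ceil_le.1 hm
  obtain ⟨η, hη, hη0, hηc⟩ := g.exists_approx m
  obtain ⟨hmη, hd⟩ := hηc m trivial le_rfl
  have h1 := k₄ η hη hη0 m hmη ((le_max_right _ _).trans hm')
  have h2 : R₃ < dist O (γ.1 m) := by
    have := dist_triangle O (γ.1 m) (η.toFun m)
    simp only at hd
    linarith
  obtain ⟨σ, hσ, hσ0, hσ1, hσR, hσL⟩ := k₃ _ h2
  have hnn : nndist (σ.toFun σ.len) (η.toFun m) ≤ K := by
    rw [hσ1, ← NNReal.coe_le_coe, hK]; exact hd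
  have h3 := (dist_min_le hσ hη (hσ0.trans hη0.symm) le_rfl hmη hnn).2
  refine k₁ _ _ _ hσL _ ⟨γ, rfl, rfl⟩ (k₂ _ _ (isGoodCurve_of_mem_LbarAt hσL) g
    (min σ.len m) (le_min hσR ((le_max_left _ _).trans hm')) (min_le_left σ.len m) trivial ?_)
  have h4 := (hηc (min σ.len m) trivial (min_le_right _ _)).2
  simp only at h4 ⊢
  have := dist_triangle_right (σ.toFun (min σ.len m)) (γ.1 (min σ.len m))
    (η.toFun (min σ.len m))
  linarith

/-- Arzelà–Ascoli on integer times: segments from `O` to the points, extended by their endpoints,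
lie in a product of closed balls, compact by Tychonoff. A subsequential limit is a ray. -/
lemma exists_subseq_tendsto_boundary [ProperSpace X] {x : ℕ → X}
    (hx : Tendsto (fun n => dist O (x n)) atTop atTop) :
    ∃ (ξ : S.Boundary O) (φ : ℕ → ℕ), StrictMono φ ∧
      Tendsto (fun n => S.gprod O (Sum.inl (x (φ n))) (Sum.inr ξ)) atTop (𝓝 ∞) := by
  choose σ hσ hσ0 hσ1 using fun n => S.isCoarselyConvex.connecting O (x n)
  have hqg := fun n => S.isCoarselyConvex.quasiGeodesic (σ n) (hσ n)
  have hlam := S.lam_pos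
  have hlen : Tendsto (fun n => (σ n).len) atTop atTop := by
    rw [tendsto_atTop]
    intro R
    filter_upwards [hx.eventually_gt_atTop (S.lam * R + S.k)] with n hn
    have h2 := (hqg n 0 (σ n).len zero_le le_rfl).2
    rw [hσ0, hσ1] at h2
    simp only [NNReal.coe_zero, zero_sub, abs_neg, NNReal.abs_eq] at h2
    rw [← NNReal.coe_le_coe]
    exact le_of_mul_le_mul_left (by linarith) hlam
  let u : ℕ → ℕ → X := fun n j => (σ n).toFun (min (j : ℝ≥0) (σ n).len)
  have hcpt : IsCompact (Set.pi Set.univ fun j : ℕ =>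
      Metric.closedBall O (S.lam * j + S.k)) :=
    isCompact_univ_pi fun j => isCompact_closedBall _ _
  have hu : ∀ n, u n ∈ Set.pi Set.univ fun j : ℕ => Metric.closedBall O (S.lam * j + S.k) := by
    intro n j _
    have h2 := (hqg n (min (j : ℝ≥0) (σ n).len) 0 (min_le_right _ _) zero_le).2
    rw [hσ0] at h2
    rw [Metric.mem_closedBall]
    refine h2.trans ?_
    simp only [NNReal.coe_zero, sub_zero, NNReal.abs_eq]
    gcongr
    exact_mod_cast min_le_left (j : ℝ≥0) (σ n).len
  obtain ⟨g, -, φ, hφ, hlim⟩ := hcpt.tendsto_subseq hu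
  rw [tendsto_pi_nhds] at hlim
  have hlen' := hlen.comp hφ.tendsto_atTop
  have hpt : ∀ m : ℕ, Tendsto (fun n => (σ (φ n)).toFun m) atTop (𝓝 (g m)) := by
    intro m
    refine (hlim m).congr' ?_
    filter_upwards [hlen'.eventually_ge_atTop (m : ℝ≥0)] with n hn
    change (σ (φ n)).toFun (min (m : ℝ≥0) _) = _
    exact congrArg _ (min_eq_left hn)
  have hg0 : g 0 = O := by
    refine tendsto_nhds_unique (hpt 0) ?_
    simp only [Nat.cast_zero, hσ0]
    exact tendsto_const_nhds
  let γ : S.LinfAt O := ⟨fun t => g ⌊t⌋₊, ⟨⟨fun n => σ (φ n), fun n => hσ _, hlen',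
    fun n => by simp [hσ0, hg0], fun m => by simpa using hpt m⟩, fun t => by simp⟩, by simp [hg0]⟩
  refine ⟨Boundary.mk S γ, φ, hφ, ?_⟩
  rw [tendsto_gprod_iff]
  intro R
  obtain ⟨R₁, k₁⟩ := exists_lt_gprod_of_near S O R
  have hev : ∀ᶠ n in atTop, ∀ m ∈ Finset.range (⌊R₁⌋₊ + 1),
      dist ((σ (φ n)).toFun m) (g m) < 1 := by
    rw [Filter.eventually_all_finset]
    intro m _
    exact (Metric.tendsto_nhds.1 (hpt m)) 1 one_pos
  filter_upwards [hev, hlen'.eventually_ge_atTop (max R₁ (2 * S.θ 0))] with n hn hl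
  refine k₁ _ _ ⟨Set.Iic (σ (φ n)).len, (σ (φ n)).toFun⟩
    ⟨σ (φ n), hσ _, (le_max_right _ _).trans hl, hσ0 _, hσ1 _, rfl⟩ ⟨Set.univ, γ.1⟩
    ⟨γ, rfl, rfl⟩ fun t ht => ?_
  have htl : t ≤ (σ (φ n)).len := ht.trans ((le_max_left _ _).trans hl)
  refine ⟨htl, trivial, ?_⟩
  have h2 := hn ⌊t⌋₊ (Finset.mem_range.2 (Nat.lt_succ_of_le (Nat.floor_le_floor ht)))
  have h3 := dist_floor_le (hσ (φ n)) htl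
  have h4 := dist_triangle_left ((σ (φ n)).toFun t) (g ⌊t⌋₊) ((σ (φ n)).toFun (⌊t⌋₊ : ℝ≥0))
  have := S.four_mul_k₁_add_C_le_D
  have := S.one_le_k₁
  have := S.isCoarselyConvex.C_nonneg
  change dist ((σ (φ n)).toFun t) (g ⌊t⌋₊) ≤ _
  linarith

end Limits

end GoodSystem

/-! ### The induced boundary map and the two implications -/

section Maps

open GoodSystem

variable {X : Type u} {Y : Type v} [MetricSpace X] [MetricSpace Y] {S : GoodSystem X}
  {T : GoodSystem Y} {a : X} {b : Y} {f : X → Y}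

/-- The sequential condition is made uniform by applying it to a sequence of counterexamples. -/
lemma IsVisual.exists_forall_lt_gprod (hf : IsVisual S T a b f) (R : ℝ≥0) :
    ∃ R' : ℝ≥0, ∀ x y : X, R' < S.gprod a (Sum.inl x) (Sum.inl y) →
      R < T.gprod b (Sum.inl (f x)) (Sum.inl (f y)) := by
  by_contra! h
  choose x y h₁ h₂ using fun n : ℕ => h n
  have h₃ := hf.2 x y (ENNReal.tendsto_nhds_top fun n => by
    filter_upwards [eventually_ge_atTop n] with m hm
    exact lt_of_le_of_lt (by exact_mod_cast hm) (h₁ m))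
  obtain ⟨n, hn⟩ := (tendsto_gprod_iff.1 h₃ R).exists
  exact absurd hn (h₂ n).not_gt

lemma IsVisual.tendsto_gprod {ι : Type*} {l : Filter ι} (hf : IsVisual S T a b f) {x y : ι → X}
    (h : Tendsto (fun i => S.gprod a (Sum.inl (x i)) (Sum.inl (y i))) l (𝓝 ∞)) :
    Tendsto (fun i => T.gprod b (Sum.inl (f (x i))) (Sum.inl (f (y i)))) l (𝓝 ∞) := by
  rw [tendsto_gprod_iff] at h ⊢
  intro R
  obtain ⟨R', k⟩ := hf.exists_forall_lt_gprod R
  exact (h R').mono fun i hi => k _ _ hi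

lemma isInducedBy_iff {g : S.Boundary a → T.Boundary b} :
    IsInducedBy S T a b f g ↔ ∀ γ : S.LinfAt a, Tendsto (fun m : ℕ =>
      T.gprod b (Sum.inl (f (γ.1 m))) (Sum.inr (g (Boundary.mk S γ)))) atTop (𝓝 ∞) :=
  forall_congr' fun _ => tendsto_nhdsAt_inr_iff

lemma IsVisual.exists_tendsto_gprod [ProperSpace Y] (hf : IsVisual S T a b f)
    (γ : S.LinfAt a) : ∃ ζ : T.Boundary b,
      Tendsto (fun m : ℕ => T.gprod b (Sum.inl (f (γ.1 m))) (Sum.inr ζ)) atTop (𝓝 ∞) := by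
  have hray := tendsto_gprod_ray γ
  -- The product of `f(γ(m))` with itself diverges; this serves only to show that these points go to
  -- infinity. The whole sequence then has the limit of its subsequence.
  have hself := hf.tendsto_gprod (tendsto_gprod_trans hray (tendsto_gprod_comm.1 hray))
  obtain ⟨ζ, φ, hφ, hζ⟩ :=
    exists_subseq_tendsto_boundary (S := T) (tendsto_dist_of_tendsto_gprod hself)
  refine ⟨ζ, tendsto_gprod_trans (hf.tendsto_gprod (tendsto_gprod_trans hray ?_)) hζ⟩
  exact tendsto_gprod_comm.1 (hray.comp hφ.tendsto_atTop)

lemma IsVisual.existsUnique_isInducedBy [ProperSpace Y] (hf : IsVisual S T a b f) :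
    ∃! g : S.Boundary a → T.Boundary b, IsInducedBy S T a b f g := by
  choose z hz using fun γ : S.LinfAt a => hf.exists_tendsto_gprod (T := T) (b := b) γ
  have hwd : ∀ γ η : S.LinfAt a, Boundary.mk S γ = Boundary.mk S η → z γ = z η := by
    intro γ η h
    have h₁ := tendsto_gprod_ray γ
    have h₂ := tendsto_gprod_ray η
    rw [← h] at h₂
    exact eq_of_tendsto_gprod (hz γ) (tendsto_gprod_trans
      (hf.tendsto_gprod (tendsto_gprod_trans h₁ (tendsto_gprod_comm.1 h₂))) (hz η))
  refine ⟨Quotient.lift z fun γ η h => hwd γ η (Quotient.sound h),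
    isInducedBy_iff.2 fun γ => hz γ, fun g hg => ?_⟩
  funext ξ
  induction ξ using Quotient.inductionOn with | _ γ
  exact eq_of_tendsto_gprod (isInducedBy_iff.1 hg γ) (hz γ)

lemma IsVisual.tendsto_gprod_induced (hf : IsVisual S T a b f)
    {g : S.Boundary a → T.Boundary b} (hg : IsInducedBy S T a b f g) {x : ℕ → X}
    {ξ : S.Boundary a}
    (hx : Tendsto (fun n => S.gprod a (Sum.inl (x n)) (Sum.inr ξ)) atTop (𝓝 ∞)) :
    Tendsto (fun n => T.gprod b (Sum.inl (f (x n))) (Sum.inr (g ξ))) atTop (𝓝 ∞) := by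
  induction ξ using Quotient.inductionOn with | _ γ
  exact tendsto_gprod_trans (hf.tendsto_gprod (tendsto_gprod_trans hx
    (tendsto_gprod_comm.1 (tendsto_gprod_ray γ)))) (isInducedBy_iff.1 hg γ)

lemma exists_subseq_forall_tendsto_boundary [ProperSpace X] {N : ℕ} {x : Fin N → ℕ → X}
    (hx : ∀ i, Tendsto (fun n => dist a (x i n)) atTop atTop) :
    ∃ (ξ : Fin N → S.Boundary a) (φ : ℕ → ℕ), StrictMono φ ∧ ∀ i,
      Tendsto (fun n => S.gprod a (Sum.inl (x i (φ n))) (Sum.inr (ξ i))) atTop (𝓝 ∞) := by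
  induction N with
  | zero => exact ⟨Fin.elim0, id, strictMono_id, fun i => i.elim0⟩
  | succ N ih =>
    obtain ⟨ξ, φ, hφ, h⟩ := ih (x := fun i => x i.succ) fun i => hx i.succ
    obtain ⟨ζ, ψ, hψ, h'⟩ :=
      exists_subseq_tendsto_boundary (S := S) ((hx 0).comp hφ.tendsto_atTop)
    refine ⟨Fin.cons ζ ξ, φ ∘ ψ, hφ.comp hψ, fun i => ?_⟩
    induction i using Fin.cases with
    | zero => exact h'
    | succ i => exact (h i).comp hψ.tendsto_atTop

lemma IsLargeScaleLipschitz.tendsto_dist {ι : Type*} {l : Filter ι}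
    (hf : IsLargeScaleLipschitz f) {x : ι → X}
    (h : Tendsto (fun i => dist b (f (x i))) l atTop) :
    Tendsto (fun i => dist a (x i)) l atTop := by
  obtain ⟨A, B, hA, -, hAB⟩ := hf
  rw [tendsto_atTop]
  intro R
  filter_upwards [h.eventually_ge_atTop (A * R + B + dist b (f a))] with i hi
  have h₁ := dist_triangle b (f a) (f (x i))
  have h₂ := hAB a (x i)
  exact le_of_mul_le_mul_left (a := A) (by linarith) (by linarith)

lemma IsVisual.isVisuallyNToOne [ProperSpace X] (hf : IsVisual S T a b f)
    {g : S.Boundary a → T.Boundary b} (hg : IsInducedBy S T a b f g) {n : ℕ} (hn : 1 ≤ n)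
    (h : IsNToOne n g) : IsVisuallyNToOne S T a b n f := by
  by_contra hcon
  unfold IsVisuallyNToOne at hcon
  push Not at hcon
  obtain ⟨R, hR, hcon⟩ := hcon
  choose x hxR hxS using fun m : ℕ => hcon (m + 1) (by positivity)
  have hlt : ∀ i j, i < j → Tendsto (fun m => T.gprod b (Sum.inl (f (x m i)))
      (Sum.inl (f (x m j)))) atTop (𝓝 ∞) := by
    intro i j hij
    refine ENNReal.tendsto_nhds_top fun M => ?_
    filter_upwards [eventually_ge_atTop M] with m hm
    refine lt_of_lt_of_le ?_ (hxS m i j hij)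
    rw [ENNReal.lt_ofReal_iff_toReal_lt (by simp)]
    simp only [ENNReal.toReal_natCast]
    have : (M : ℝ) ≤ m := by exact_mod_cast hm
    linarith
  have hne : ∀ i j, i ≠ j → Tendsto (fun m => T.gprod b (Sum.inl (f (x m i)))
      (Sum.inl (f (x m j)))) atTop (𝓝 ∞) := fun i j hij =>
    hij.lt_or_gt.elim (hlt i j) fun h => tendsto_gprod_comm.1 (hlt j i h)
  -- Here `1 ≤ n` enters: a second index is needed for a diverging product to push each image, and
  -- so each `x m i`, to infinity.
  have : Nontrivial (Fin (n + 1)) := Fin.nontrivial_iff_two_le.2 (by lia)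
  have hfar : ∀ i, Tendsto (fun m => dist a (x m i)) atTop atTop := fun i => by
    obtain ⟨j, hj⟩ := exists_ne i
    exact hf.1.tendsto_dist (tendsto_dist_of_tendsto_gprod (hne i j hj.symm))
  obtain ⟨ξ, φ, hφ, hξ⟩ :=
    exists_subseq_forall_tendsto_boundary (S := S) (x := fun i m => x m i) hfar
  have hinj : Function.Injective ξ := by
    intro i j hij
    by_contra hne'
    have h₁ := hξ j
    rw [← hij] at h₁
    obtain ⟨m, hm⟩ := (tendsto_gprod_iff.1
      (tendsto_gprod_trans (hξ i) (tendsto_gprod_comm.1 h₁)) R.toNNReal).exists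
    exact absurd hm (hxR (φ m) i j hne').not_gt
  have hgξ : ∀ i, g (ξ i) = g (ξ 0) := by
    intro i
    rcases eq_or_ne i 0 with rfl | hi
    · rfl
    · exact eq_of_tendsto_gprod (hf.tendsto_gprod_induced hg (hξ i)) (tendsto_gprod_trans
        ((hne i 0 hi).comp hφ.tendsto_atTop) (hf.tendsto_gprod_induced hg (hξ 0)))
  have hsub : Set.range ξ ⊆ g ⁻¹' {g (ξ 0)} := by
    rintro _ ⟨i, rfl⟩
    exact hgξ i
  have hcard := (Set.encard_le_encard hsub).trans (h (g (ξ 0)))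
  rw [← Set.image_univ, hinj.encard_image, Set.encard_univ, ENat.card_eq_coe_fintype_card,
    Fintype.card_fin] at hcard
  have : n + 1 ≤ n := by exact_mod_cast hcard
  lia

lemma exists_forall_gprod_le_of_ne {γ η : S.LinfAt a}
    (h : Boundary.mk S γ ≠ Boundary.mk S η) :
    ∃ (R : ℝ≥0) (N : ℕ), ∀ m ≥ N,
      S.gprod a (Sum.inl (γ.1 m)) (Sum.inl (η.1 m)) ≤ R := by
  by_contra! hcon
  refine h ?_
  choose m hm hm' using fun n : ℕ => hcon n n
  have hmt : Tendsto m atTop atTop := tendsto_atTop_mono hm tendsto_id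
  have h₁ : Tendsto (fun n => S.gprod a (Sum.inl (γ.1 (m n))) (Sum.inl (η.1 (m n)))) atTop
      (𝓝 ∞) := ENNReal.tendsto_nhds_top fun n => by
    filter_upwards [eventually_ge_atTop n] with i hi
    exact lt_of_le_of_lt (by exact_mod_cast hi) (hm' i)
  exact eq_of_tendsto_gprod ((tendsto_gprod_ray γ).comp hmt)
    (tendsto_gprod_trans h₁ ((tendsto_gprod_ray η).comp hmt))

lemma IsInducedBy.isNToOne {g : S.Boundary a → T.Boundary b} (hg : IsInducedBy S T a b f g)
    {n : ℕ} (h : IsVisuallyNToOne S T a b n f) : IsNToOne n g := by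
  intro z
  by_contra! hcon
  have hcard : ((n + 1 : ℕ) : ℕ∞) ≤ (g ⁻¹' {z}).encard := by
    simpa using Order.add_one_le_of_lt hcon
  obtain ⟨s, hs, hsn⟩ := Set.exists_subset_encard_eq hcard
  have hfin : s.Finite := Set.finite_of_encard_eq_coe hsn
  -- The fibre may be infinite, hence the subset of exactly `n + 1` points.
  have hsn' : hfin.toFinset.card = n + 1 := by
    rw [hfin.encard_eq_coe_toFinset_card] at hsn
    exact_mod_cast hsn
  let e := (Finset.equivFinOfCardEq hsn').symm
  choose γ hγ using fun i => Quotient.exists_rep (e i).1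
  have hne : ∀ i j, i ≠ j → Boundary.mk S (γ i) ≠ Boundary.mk S (γ j) := fun i j hij h' =>
    hij (e.injective (Subtype.ext ((hγ i).symm.trans (h'.trans (hγ j)))))
  have hgz : ∀ i, g (Boundary.mk S (γ i)) = z := fun i =>
    (congrArg g (hγ i)).trans (hs (hfin.mem_toFinset.1 (e i).2))
  have hbdd : ∀ ij : Fin (n + 1) × Fin (n + 1), ∃ R : ℝ≥0, ij.1 ≠ ij.2 → ∀ᶠ m : ℕ in atTop,
      S.gprod a (Sum.inl ((γ ij.1).1 m)) (Sum.inl ((γ ij.2).1 m)) ≤ R := by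
    intro ij
    by_cases hij : ij.1 = ij.2
    · exact ⟨0, fun h' => absurd hij h'⟩
    · obtain ⟨R, N, hR⟩ := exists_forall_gprod_le_of_ne (hne _ _ hij)
      exact ⟨R, fun _ => eventually_atTop.2 ⟨N, hR⟩⟩
  choose R hR using hbdd
  obtain ⟨M, hM⟩ := Finite.exists_le R
  -- The eventual bounds by `M` are not strict, whereas (B) asks for strict ones.
  obtain ⟨r, -, hr⟩ := h (M + 1) (by positivity)
  have h₁ : ∀ᶠ m : ℕ in atTop, ∀ ij : Fin (n + 1) × Fin (n + 1), ij.1 ≠ ij.2 →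
      S.gprod a (Sum.inl ((γ ij.1).1 m)) (Sum.inl ((γ ij.2).1 m)) ≤ R ij := by
    simp only [eventually_all]
    exact hR
  have h₂ : ∀ᶠ m : ℕ in atTop, ∀ i j : Fin (n + 1), (r.toNNReal : ℝ≥0∞) <
      T.gprod b (Sum.inl (f ((γ i).1 m))) (Sum.inl (f ((γ j).1 m))) := by
    simp only [eventually_all]
    intro i j
    have hi := isInducedBy_iff.1 hg (γ i)
    have hj := isInducedBy_iff.1 hg (γ j)
    rw [hgz] at hi hj
    exact tendsto_gprod_iff.1 (tendsto_gprod_trans hi (tendsto_gprod_comm.1 hj)) _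
  obtain ⟨m, hm₁, hm₂⟩ := (h₁.and h₂).exists
  obtain ⟨i, j, -, hij⟩ := hr (fun i => (γ i).1 m) fun i j hij => by
    refine lt_of_le_of_lt (hm₁ (i, j) hij) (ENNReal.coe_lt_coe.2 ?_)
    rw [Real.lt_toNNReal_iff_coe_lt]
    have : (R (i, j) : ℝ) ≤ M := by exact_mod_cast hM (i, j)
    linarith
  exact absurd hij (hm₂ i j).not_gt

end Maps

end CoarseConvex

open CoarseConvex in
theorem proposition5p1 {X Y : Type*} [MetricSpace X] [ProperSpace X] [MetricSpace Y]
    [ProperSpace Y] (S : GoodSystem X) (T : GoodSystem Y) (a : X) (b : Y) (f : X → Y)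
    (hf : IsVisual S T a b f) (n : ℕ) (hn : 1 ≤ n) :
    (∃! g : S.Boundary a → T.Boundary b, IsInducedBy S T a b f g) ∧
      ∀ g : S.Boundary a → T.Boundary b, IsInducedBy S T a b f g →
        (IsNToOne n g ↔ IsVisuallyNToOne S T a b n f) :=
  ⟨hf.existsUnique_isInducedBy, fun _ hg =>
    ⟨hf.isVisuallyNToOne hg hn, hg.isNToOne⟩⟩
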